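/- Let $F$ be a field of characteristic different from $2$. A Lie-Jordan algebra over $F$ is an $F$-vector space $L$, of arbitrary dimension, with a bilinear operation $[x,y]$ and a trilinear operation $T(x,y,z)$ satisfying, for all elements of $L$, $$[x,y]=-[y,x],\qquad T(x,y,z)=T(z,y,x),\qquad [[x,y],z]=T(x,y,z)-T(y,x,z),$$ $$[t,T(x,y,z)]=T([t,x],y,z)+T(x,[t,y],z)+T(x,y,[t,z]),$$ $$T(T(x,y,z),t,v)=T(T(x,t,v),y,z)-T(x,T(y,v,t),z)+T(x,y,T(z,t,v)).$$ An ideal of $L$ is a subspace $I$ such that $[x,y]\in I$ whenever $x$ or $y$ is in $I$, and $T(x,y,z)\in I$ whenever one of $x,y,z$ is in $I$; $L$ is simple if its operations are not both zero and its only ideals are $0$ and $L$. Let $A$ be an associative $F$-algebra, not necessarily with unit, with an involution $*$, that is, an $F$-linear map $*:A\to A$ with $(ab)^*=b^*a^*$ and $(a^*)^*=a$. The algebra $(A,*)$ is $*$-simple if $A^2\neq 0$ and the only two-sided ideals $I$ of $A$ with $I^*\subseteq I$ are $0$ and $A$. Put $K(A,*)=\{a\in A : a^*=-a\}$; with the operations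 $[a,b]=ab-ba$ and $T(a,b,c)=abc+cba$ it is a Lie-Jordan algebra. Theorem. (1) Every simple Lie-Jordan algebra over $F$ is isomorphic to the Lie-Jordan algebra $K(A,*)$ for some $*$-simple associative $F$-algebra with involution $(A,*)$ such that $A$ is generated, as a not necessarily unital algebra, by its skew elements $K(A,*)$. (2) Conversely, for every $*$-simple associative $F$-algebra with involution $(A,*)$ such that $A$ is generated, as a not necessarily unital algebra, by $K(A,*)$, the Lie-Jordan algebra $K(A,*)$ is simple. -/

import Mathlib

universe u v w

/-- A Lie-Jordan algebra structure on an `F`-vector space `L`: a bilinear operation `[x, y]` and a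
trilinear operation `T(x, y, z)` subject to the five defining identities. -/
structure LieJordanAlgebra (F : Type*) (L : Type*) [Field F] [AddCommGroup L] [Module F L] where
  /-- the bilinear operation `[x, y]` -/
  bracket : L →ₗ[F] L →ₗ[F] L
  /-- the trilinear operation `T(x, y, z)` -/
  triple : L →ₗ[F] L →ₗ[F] L →ₗ[F] L
  bracket_skew : ∀ x y, bracket x y = -bracket y x
  triple_symm : ∀ x y z, triple x y z = triple z y x
  bracket_bracket : ∀ x y z, bracket (bracket x y) z = triple x y z - triple y x z
  bracket_triple : ∀ t x y z, bracket t (triple x y z) =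
    triple (bracket t x) y z + triple x (bracket t y) z + triple x y (bracket t z)
  triple_triple : ∀ x y z t v, triple (triple x y z) t v =
    triple (triple x t v) y z - triple x (triple y v t) z + triple x y (triple z t v)

namespace LieJordanAlgebra

/-- A subspace is an ideal if each operation lands in it as soon as one argument lies in it. -/
def IsIdeal {F L : Type*} [Field F] [AddCommGroup L] [Module F L]
    (S : LieJordanAlgebra F L) (I : Submodule F L) : Prop :=
  (∀ x y, x ∈ I ∨ y ∈ I → S.bracket x y ∈ I) ∧
  (∀ x y z, x ∈ I ∨ y ∈ I ∨ z ∈ I → S.triple x y z ∈ I)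

/-- A Lie-Jordan algebra is simple if its operations are not both zero and it has no ideals other
than `0` and itself. -/
def IsSimple {F L : Type*} [Field F] [AddCommGroup L] [Module F L]
    (S : LieJordanAlgebra F L) : Prop :=
  (S.bracket ≠ 0 ∨ S.triple ≠ 0) ∧ ∀ I : Submodule F L, S.IsIdeal I → I = ⊥ ∨ I = ⊤

/-- Two Lie-Jordan algebras are isomorphic if some linear bijection respects both operations. -/
def Isomorphic {F L L' : Type*} [Field F] [AddCommGroup L] [Module F L]
    [AddCommGroup L'] [Module F L']
    (S : LieJordanAlgebra F L) (S' : LieJordanAlgebra F L') : Prop :=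
  ∃ e : L ≃ₗ[F] L', (∀ x y, e (S.bracket x y) = S'.bracket (e x) (e y)) ∧
    ∀ x y z, e (S.triple x y z) = S'.triple (e x) (e y) (e z)

end LieJordanAlgebra

/-- An involution of a (not necessarily unital) associative `F`-algebra `A`: an `F`-linear map
`* : A → A` with `(ab)* = b* a*` and `a** = a`. -/
structure AlgInvolution (F : Type*) (A : Type*) [Field F] [NonUnitalRing A] [Module F A] where
  toLin : A →ₗ[F] A
  map_mul : ∀ a b, toLin (a * b) = toLin b * toLin a
  involutive : ∀ a, toLin (toLin a) = a

namespace AlgInvolution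

/-- The subspace `K(A, *)` of skew elements `a* = -a`. -/
def skew {F A : Type*} [Field F] [NonUnitalRing A] [Module F A]
    (σ : AlgInvolution F A) : Submodule F A where
  carrier := {a | σ.toLin a = -a}
  add_mem' {a b} ha hb := by
    change σ.toLin (a + b) = -(a + b)
    change σ.toLin a = -a at ha
    change σ.toLin b = -b at hb
    rw [map_add, ha, hb, neg_add]
  zero_mem' := by simp
  smul_mem' c a ha := by
    change σ.toLin (c • a) = -(c • a)
    change σ.toLin a = -a at ha
    rw [map_smul, ha, smul_neg]

theorem mem_skew {F A : Type*} [Field F] [NonUnitalRing A] [Module F A]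
    (σ : AlgInvolution F A) {a : A} : a ∈ σ.skew ↔ σ.toLin a = -a := Iff.rfl

theorem bracket_mem_skew {F A : Type*} [Field F] [NonUnitalRing A] [Module F A]
    (σ : AlgInvolution F A) {a b : A} (ha : a ∈ σ.skew) (hb : b ∈ σ.skew) :
    a * b - b * a ∈ σ.skew := by
  rw [mem_skew] at *
  rw [map_sub, σ.map_mul, σ.map_mul, ha, hb]
  noncomm_ring

theorem triple_mem_skew {F A : Type*} [Field F] [NonUnitalRing A] [Module F A]
    (σ : AlgInvolution F A) {a b c : A} (ha : a ∈ σ.skew) (hb : b ∈ σ.skew) (hc : c ∈ σ.skew) :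
    a * b * c + c * b * a ∈ σ.skew := by
  rw [mem_skew] at *
  rw [map_add, σ.map_mul, σ.map_mul, σ.map_mul, σ.map_mul, ha, hb, hc]
  noncomm_ring

/-- `K(A, *)` as a Lie-Jordan algebra, with `[a, b] = ab - ba` and `T(a, b, c) = abc + cba`. -/
def skewLieJordan {F A : Type*} [Field F] [NonUnitalRing A] [Module F A]
    [IsScalarTower F A A] [SMulCommClass F A A] (σ : AlgInvolution F A) :
    LieJordanAlgebra F σ.skew where
  bracket := LinearMap.mk₂ F
    (fun a b => ⟨(a : A) * b - b * a, σ.bracket_mem_skew a.2 b.2⟩)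
    (fun a a' b => Subtype.ext (by simp only [Submodule.coe_add]; noncomm_ring))
    (fun c a b => Subtype.ext (by simp [smul_sub, smul_mul_assoc, mul_smul_comm]))
    (fun a b b' => Subtype.ext (by simp only [Submodule.coe_add]; noncomm_ring))
    (fun c a b => Subtype.ext (by simp [smul_sub, smul_mul_assoc, mul_smul_comm]))
  triple := LinearMap.mk₂ F
    (fun a b =>
      { toFun := fun c => ⟨(a : A) * b * c + c * b * a, σ.triple_mem_skew a.2 b.2 c.2⟩
        map_add' := fun c c' => Subtype.ext (by simp only [Submodule.coe_add]; noncomm_ring)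
        map_smul' := fun r c => Subtype.ext (by
          simp [smul_add, smul_mul_assoc, mul_smul_comm]) })
    (fun a a' b => LinearMap.ext fun c => Subtype.ext (by
      simp only [Submodule.coe_add, LinearMap.coe_mk, AddHom.coe_mk, LinearMap.add_apply]
      noncomm_ring))
    (fun r a b => LinearMap.ext fun c => Subtype.ext (by
      simp [smul_add, smul_mul_assoc, mul_smul_comm]))
    (fun a b b' => LinearMap.ext fun c => Subtype.ext (by
      simp only [Submodule.coe_add, LinearMap.coe_mk, AddHom.coe_mk, LinearMap.add_apply]
      noncomm_ring))
    (fun r a b => LinearMap.ext fun c => Subtype.ext (by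
      simp [smul_add, smul_mul_assoc, mul_smul_comm]))
  bracket_skew x y := Subtype.ext (by
    simp only [LinearMap.mk₂_apply, Submodule.coe_neg]; noncomm_ring)
  triple_symm x y z := Subtype.ext (by
    simp only [LinearMap.mk₂_apply, LinearMap.coe_mk, AddHom.coe_mk]; noncomm_ring)
  bracket_bracket x y z := Subtype.ext (by
    simp only [LinearMap.mk₂_apply, LinearMap.coe_mk, AddHom.coe_mk, Submodule.coe_sub]
    noncomm_ring)
  bracket_triple t x y z := Subtype.ext (by
    simp only [LinearMap.mk₂_apply, LinearMap.coe_mk, AddHom.coe_mk, Submodule.coe_add]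
    noncomm_ring)
  triple_triple x y z t v := Subtype.ext (by
    simp only [LinearMap.mk₂_apply, LinearMap.coe_mk, AddHom.coe_mk, Submodule.coe_add,
      Submodule.coe_sub]
    noncomm_ring)

theorem coe_skewLieJordan_bracket {F A : Type*} [Field F] [NonUnitalRing A] [Module F A]
    [IsScalarTower F A A] [SMulCommClass F A A] (σ : AlgInvolution F A) (a b : σ.skew) :
    (σ.skewLieJordan.bracket a b : A) = a * b - b * a := rfl

theorem coe_skewLieJordan_triple {F A : Type*} [Field F] [NonUnitalRing A] [Module F A]
    [IsScalarTower F A A] [SMulCommClass F A A] (σ : AlgInvolution F A) (a b c : σ.skew) :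
    (σ.skewLieJordan.triple a b c : A) = a * b * c + c * b * a := rfl

/-- `(A, *)` is `*`-simple if the product of `A` is not zero and the only two-sided ideals stable
under `*` are `0` and `A`. -/
def IsStarSimple {F A : Type*} [Field F] [NonUnitalRing A] [Module F A]
    (σ : AlgInvolution F A) : Prop :=
  (∃ a b : A, a * b ≠ 0) ∧
  ∀ I : Submodule F A, (∀ a, ∀ x ∈ I, a * x ∈ I ∧ x * a ∈ I) → (∀ x ∈ I, σ.toLin x ∈ I) →
    I = ⊥ ∨ I = ⊤

/-- `A` is generated, as an algebra (without using a unit), by its skew elements. -/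
def GeneratedBySkew {F A : Type*} [Field F] [NonUnitalRing A] [Module F A]
    [IsScalarTower F A A] [SMulCommClass F A A] (σ : AlgInvolution F A) : Prop :=
  NonUnitalAlgebra.adjoin F (σ.skew : Set A) = ⊤

end AlgInvolution

/-!
Let `K` be a space of skew elements of an associative algebra with involution, closed under
`[x, y]` and `T(x, y, z)`. Since
`2xyz = T(x, y, z) + [x, y]z + y[x, z] + [y, z]x`, the algebra generated by `K` is `K + K ∘ K`,
where `x ∘ y = xy + yx` is symmetric (`jordanHull_self_eq_top`). Hence `K` contains all skew elements
of this algebra, and an ideal `I` of `K` generates the `*`-ideal `I + I ∘ K`, which meets `K` in `I`.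
This is why `K(A, *)` has no proper ideals when `A` is `*`-simple
(`skewLieJordan_ideal_eq_bot_or_top`).

Conversely, an abstract Lie-Jordan algebra `L` is realized in associative algebras as follows. In an
envelope the symmetric element `x ∘ y` acts on `L` by Jordan multiplication, that is, by the operator
`symOp x y : k ↦ T(x, y, k) + T(y, x, k)`. Take the span of these operators as the symmetric part,
and let `x` in `L` act on `F ⊕ L ⊕ symSpan` as left and right multiplication should: half the sum and
half the difference of a Jordan multiplication `jor x` and a commutator `der x`. The identity
`[jor x, jor y] = der [x, y]` follows from the fifth axiom, which describes `h T(x, y, z)` for `h` in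
`symSpan`. It makes `left` a representation of the Lie bracket commuting with all operators `right`.
The defect `left x left y left z + left z left y left x - left T(x, y, z)` is then invariant under
`L` and kills the unit, so it vanishes (`left_triple`).

The pairs `(left x, -left x)` in `End × Endᵒᵖ`, with the exchange involution, generate the envelope
of `L`. When `L` is simple it is already `*`-simple: a `*`-ideal either contains `L`, hence
everything, or meets `L` in `0`, and then its elements are symmetric and annihilate `L` under Jordan
multiplication. By the choice of the symmetric part such an element kills the unit of
`F ⊕ L ⊕ symSpan`; as it commutes with all `right x`, it is zero (`eq_zero_of_jordan_eq_zero`).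
-/

/-! ### The regular representation of a Lie-Jordan algebra -/

namespace LieJordanAlgebra

variable {F L : Type*} [Field F] [AddCommGroup L] [Module F L] (S : LieJordanAlgebra F L)

/-- The Jacobi identity. -/
theorem bracket_eq_comm (x y : L) :
    S.bracket (S.bracket x y) = S.bracket x * S.bracket y - S.bracket y * S.bracket x := by
  ext z
  have h := S.bracket_bracket y z x
  rw [S.bracket_skew _ x] at h
  have h' := S.bracket_bracket z x y
  rw [S.bracket_skew _ y, S.bracket_skew z x, map_neg, neg_neg] at h'
  simp only [LinearMap.sub_apply, Module.End.mul_apply]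
  rw [S.bracket_bracket, h', neg_eq_iff_eq_neg.mp h, S.triple_symm y x z, S.triple_symm y z x,
    S.triple_symm z y x]
  abel

/-- The operator `k ↦ T(x, y, k) + T(y, x, k)` on `L`, bilinear and symmetric in `x` and `y`. For
skew elements of an associative algebra with involution it is the Jordan multiplication of skew
elements by the symmetric element `xy + yx`. -/
def symOp : L →ₗ[F] L →ₗ[F] Module.End F L := S.triple + S.triple.flip

theorem symOp_apply (x y k : L) : S.symOp x y k = S.triple x y k + S.triple y x k := rfl

theorem symOp_comm (x y : L) : S.symOp x y = S.symOp y x := add_comm _ _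

theorem bracket_comm_symOp (t x y : L) :
    S.bracket t * S.symOp x y - S.symOp x y * S.bracket t =
      S.symOp (S.bracket t x) y + S.symOp x (S.bracket t y) := by
  ext k
  simp only [LinearMap.sub_apply, LinearMap.add_apply, Module.End.mul_apply, symOp_apply, map_add,
    bracket_triple]
  abel

/-- The span in `End L` of all operators `symOp x y`; it stands in for the space of symmetric
elements of the associative envelope. -/
def symSpan : Submodule F (Module.End F L) :=
  Submodule.span F (Set.range fun p : L × L => S.symOp p.1 p.2)

theorem symOp_mem (x y : L) : S.symOp x y ∈ S.symSpan :=
  Submodule.subset_span ⟨(x, y), rfl⟩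

theorem comm_mem_symSpan (t : L) {h : Module.End F L} (hh : h ∈ S.symSpan) :
    S.bracket t * h - h * S.bracket t ∈ S.symSpan := by
  induction hh using Submodule.span_induction with
  | mem h hh =>
    obtain ⟨p, rfl⟩ := hh
    rw [bracket_comm_symOp]
    exact add_mem (S.symOp_mem _ _) (S.symOp_mem _ _)
  | zero => simp
  | add g h _ _ hg hh =>
    rw [mul_add, add_mul, add_sub_add_comm]
    exact add_mem hg hh
  | smul c h _ hh =>
    rw [mul_smul_comm, smul_mul_assoc, ← smul_sub]
    exact S.symSpan.smul_mem c hh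

/-- The fifth defining identity, read as a rule for applying a symmetric element to `T`. -/
theorem apply_triple_of_mem_symSpan {h : Module.End F L} (hh : h ∈ S.symSpan) (x y z : L) :
    h (S.triple x y z) = S.triple (h x) y z - S.triple x (h y) z + S.triple x y (h z) := by
  induction hh using Submodule.span_induction with
  | mem h hh =>
    obtain ⟨⟨u, v⟩, rfl⟩ := hh
    simp only [symOp_apply, map_add, LinearMap.add_apply]
    rw [S.triple_symm u v (S.triple x y z), S.triple_symm v u (S.triple x y z),
      S.triple_triple x y z v u, S.triple_triple x y z u v, S.triple_symm u v x, S.triple_symm v u x,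
      S.triple_symm u v y, S.triple_symm v u y, S.triple_symm u v z, S.triple_symm v u z]
    abel
  | zero => simp
  | add g h _ _ hg hh =>
    simp only [LinearMap.add_apply, map_add, hg, hh]
    abel
  | smul c h _ hh =>
    simp only [LinearMap.smul_apply, map_smul, hh, smul_add, smul_sub]

/-- The space `F ⊕ L ⊕ symSpan`, the underlying space of the unital associative envelope of `L`
in which a symmetric element is determined by its Jordan action on `L`. -/
abbrev Hull := F × L × S.symSpan

-- A shortcut: instance search does not find the subtraction of `End Hull` without it.
instance : AddCommGroup S.Hull := Prod.instAddCommGroup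

/-- The unit of the envelope. -/
def hullOne : S.Hull := (1, 0, 0)

/-- The action of `L` on `Hull` by commutators. -/
def der : L →ₗ[F] Module.End F S.Hull :=
  LinearMap.mk₂ F
    (fun x v => (0, S.bracket x v.2.1,
      ⟨S.bracket x * v.2.2 - v.2.2 * S.bracket x, S.comm_mem_symSpan x v.2.2.2⟩))
    (fun x x' v => Prod.ext (by simp) (Prod.ext (by simp) (Subtype.ext (by simp; noncomm_ring))))
    (fun c x v => Prod.ext (by simp) (Prod.ext (by simp) (Subtype.ext (by simp [smul_sub]))))
    (fun x v v' => Prod.ext (by simp) (Prod.ext (by simp) (Subtype.ext (by simp; noncomm_ring))))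
    (fun c x v => Prod.ext (by simp) (Prod.ext (by simp) (Subtype.ext (by simp [smul_sub]))))

/-- The action of `L` on `Hull` by Jordan multiplication `v ↦ xv + vx`. -/
def jor : L →ₗ[F] Module.End F S.Hull :=
  LinearMap.mk₂ F
    (fun x v => (0, (2 * v.1) • x + (v.2.2 : Module.End F L) x,
      ⟨S.symOp x v.2.1, S.symOp_mem x v.2.1⟩))
    (fun x x' v => Prod.ext (by simp) (Prod.ext (by simp; abel) (Subtype.ext (by simp))))
    (fun c x v => Prod.ext (by simp)
      (Prod.ext (by simp [smul_smul, mul_comm]) (Subtype.ext (by simp))))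
    (fun x v v' => Prod.ext (by simp)
      (Prod.ext (by simp [mul_add, add_smul]; abel) (Subtype.ext (by simp))))
    (fun c x v => Prod.ext (by simp)
      (Prod.ext (by simp [smul_smul, mul_left_comm]) (Subtype.ext (by simp))))

theorem der_apply (x : L) (v : S.Hull) : S.der x v = (0, S.bracket x v.2.1,
    ⟨S.bracket x * v.2.2 - v.2.2 * S.bracket x, S.comm_mem_symSpan x v.2.2.2⟩) := rfl

theorem jor_apply (x : L) (v : S.Hull) : S.jor x v = (0, (2 * v.1) • x +
    (v.2.2 : Module.End F L) x, ⟨S.symOp x v.2.1, S.symOp_mem x v.2.1⟩) := rfl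

theorem der_comm_der (x y : L) : S.der x * S.der y - S.der y * S.der x = S.der (S.bracket x y) := by
  refine LinearMap.ext fun v => Prod.ext ?_ (Prod.ext ?_ (Subtype.ext ?_))
  · simp [der_apply]
  · simp [der_apply, bracket_eq_comm]
  · simp only [der_apply, LinearMap.sub_apply, Module.End.mul_apply, Prod.snd_sub,
      Submodule.coe_sub, bracket_eq_comm]
    noncomm_ring

theorem der_comm_jor (x y : L) : S.der x * S.jor y - S.jor y * S.der x = S.jor (S.bracket x y) := by
  refine LinearMap.ext fun v => Prod.ext ?_ (Prod.ext ?_ (Subtype.ext ?_))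
  · simp [der_apply, jor_apply]
  · simp only [der_apply, jor_apply, LinearMap.sub_apply, Module.End.mul_apply, Prod.snd_sub,
      Prod.fst_sub, map_add, map_smul, mul_zero, zero_smul, zero_add]
    abel
  · have := S.bracket_comm_symOp x y v.2.1
    simp only [der_apply, jor_apply, LinearMap.sub_apply, Module.End.mul_apply, Prod.snd_sub,
      Submodule.coe_sub, this]
    abel

/-- The relation that makes the envelope associative; on the symmetric part it amounts to
`apply_triple_of_mem_symSpan`. -/
theorem jor_comm_jor (x y : L) : S.jor x * S.jor y - S.jor y * S.jor x = S.der (S.bracket x y) := by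
  refine LinearMap.ext fun v => Prod.ext ?_ (Prod.ext ?_ (Subtype.ext ?_))
  · simp [der_apply, jor_apply]
  · simp only [der_apply, jor_apply, LinearMap.sub_apply, Module.End.mul_apply, Prod.snd_sub,
      Prod.fst_sub, symOp_apply, bracket_bracket, mul_zero, zero_smul, zero_add]
    rw [S.triple_symm x _ y, S.triple_symm v.2.1 x y, S.triple_symm v.2.1 y x]
    abel
  · ext k
    have h := S.apply_triple_of_mem_symSpan v.2.2.2
    simp only [der_apply, jor_apply, LinearMap.sub_apply, Module.End.mul_apply, Prod.snd_sub,
      Submodule.coe_sub, map_add, map_smul, LinearMap.add_apply, LinearMap.smul_apply,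
      S.symOp_comm y x, bracket_bracket, map_sub, h, symOp_apply]
    rw [S.triple_symm x _ k, S.triple_symm y _ k]
    simp only [S.triple_symm k]
    abel

/-- Left multiplication by `x` on the envelope. -/
def left : L →ₗ[F] Module.End F S.Hull := (2⁻¹ : F) • (S.der + S.jor)

/-- Right multiplication by `x` on the envelope. -/
def right : L →ₗ[F] Module.End F S.Hull := (2⁻¹ : F) • (S.jor - S.der)

theorem left_apply (x : L) : S.left x = (2⁻¹ : F) • (S.der x + S.jor x) := rfl

theorem right_apply (x : L) : S.right x = (2⁻¹ : F) • (S.jor x - S.der x) := rfl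

theorem commute_left_right (x y : L) : Commute (S.left x) (S.right y) := by
  rw [left_apply, right_apply]
  refine Commute.smul_left (Commute.smul_right ?_ (2⁻¹ : F)) (2⁻¹ : F)
  have h1 := S.jor_comm_jor x y
  rw [← S.der_comm_der] at h1
  have h2 := S.der_comm_jor x y
  have h3 := S.der_comm_jor y x
  rw [S.bracket_skew, map_neg] at h3
  rw [commute_iff_eq]
  linear_combination (norm := skip) h1 + h2 + h3
  simp only [mul_sub, sub_mul, mul_add, add_mul]
  abel

theorem left_comm_left (hF : (2 : F) ≠ 0) (x y : L) :
    S.left x * S.left y - S.left y * S.left x = S.left (S.bracket x y) := by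
  have h0 := S.der_comm_der x y
  have h1 := S.jor_comm_jor x y
  have h2 := S.der_comm_jor x y
  have h3 := S.der_comm_jor y x
  rw [S.bracket_skew, map_neg] at h3
  have h : (S.der x + S.jor x) * (S.der y + S.jor y) - (S.der y + S.jor y) * (S.der x + S.jor x)
      = (2 : F) • (S.der (S.bracket x y) + S.jor (S.bracket x y)) := by
    rw [two_smul]
    linear_combination (norm := noncomm_ring) h0 + h1 + h2 - h3
  simp only [left_apply, smul_mul_smul_comm]
  refine (smul_sub (2⁻¹ * 2⁻¹ : F) _ _).symm.trans ?_
  rw [h, smul_smul, mul_assoc, inv_mul_cancel₀ hF, mul_one]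

theorem left_hullOne (hF : (2 : F) ≠ 0) (x : L) : S.left x S.hullOne = (0, x, 0) := by
  refine Prod.ext ?_ (Prod.ext ?_ (Subtype.ext ?_)) <;>
    simp [left_apply, der_apply, jor_apply, hullOne, hF, smul_smul]

theorem right_hullOne (hF : (2 : F) ≠ 0) (x : L) : S.right x S.hullOne = (0, x, 0) := by
  refine Prod.ext ?_ (Prod.ext ?_ (Subtype.ext ?_)) <;>
    simp [right_apply, der_apply, jor_apply, hullOne, hF, smul_smul]

theorem left_skew (x y : L) : S.left x (0, y, 0) =
    (0, (2⁻¹ : F) • S.bracket x y, (2⁻¹ : F) • ⟨S.symOp x y, S.symOp_mem x y⟩) := by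
  refine Prod.ext ?_ (Prod.ext ?_ (Subtype.ext ?_)) <;>
    simp [left_apply, der_apply, jor_apply]

theorem right_skew (x y : L) : S.right x (0, y, 0) =
    (0, -(2⁻¹ : F) • S.bracket x y, (2⁻¹ : F) • ⟨S.symOp x y, S.symOp_mem x y⟩) := by
  refine Prod.ext ?_ (Prod.ext ?_ (Subtype.ext ?_)) <;>
    simp [right_apply, der_apply, jor_apply]

/-- The unit generates `Hull` both under left and under right multiplications: the hypotheses are
those values at the unit and at `L` that the two have in common. -/
theorem eq_top_of_hullOne_mem (hF : (2 : F) ≠ 0) {N : Submodule F S.Hull}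
    (h1 : S.hullOne ∈ N) (hL : ∀ x : L, ((0, x, 0) : S.Hull) ∈ N)
    (hH : ∀ x y, ∃ z : L, ((0, z, (2⁻¹ : F) • ⟨S.symOp x y, S.symOp_mem x y⟩) : S.Hull) ∈ N) :
    N = ⊤ := by
  have key : ∀ h (hh : h ∈ S.symSpan), ((0, 0, ⟨h, hh⟩) : S.Hull) ∈ N := by
    intro h hh
    induction hh using Submodule.span_induction with
    | mem h hh =>
      obtain ⟨⟨x, y⟩, rfl⟩ := hh
      obtain ⟨z, hz⟩ := hH x y
      convert N.smul_mem (2 : F) (N.sub_mem hz (hL z)) using 1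
      refine Prod.ext ?_ (Prod.ext ?_ (Subtype.ext ?_)) <;> simp [smul_smul, hF]
    | zero => exact N.zero_mem
    | add g h _ _ hg hh =>
      convert N.add_mem hg hh using 1
      refine Prod.ext ?_ (Prod.ext ?_ (Subtype.ext ?_)) <;> simp
    | smul c h _ hh =>
      convert N.smul_mem c hh using 1
      refine Prod.ext ?_ (Prod.ext ?_ (Subtype.ext ?_)) <;> simp
  refine (Submodule.eq_top_iff').mpr fun v => ?_
  convert N.add_mem (N.smul_mem v.1 h1) (N.add_mem (hL v.2.1) (key v.2.2 v.2.2.2)) using 1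
  refine Prod.ext ?_ (Prod.ext ?_ (Subtype.ext ?_)) <;> simp [hullOne]

theorem left_triple_hullOne (hF : (2 : F) ≠ 0) (x y z : L) :
    S.left x (S.left y (S.left z S.hullOne)) + S.left z (S.left y (S.left x S.hullOne)) =
      S.left (S.triple x y z) S.hullOne := by
  simp only [left_hullOne _ hF, left_skew]
  refine Prod.ext ?_ (Prod.ext ?_ (Subtype.ext ?_))
  · simp [left_apply, der_apply, jor_apply]
  · have h4 : (2⁻¹ : F) * 2⁻¹ * 4 = 1 := by
      rw [show (4 : F) = 2 * 2 by norm_num]; field_simp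
    have hx : S.bracket x (S.bracket y z) = S.triple x y z - S.triple x z y := by
      rw [S.bracket_skew, S.bracket_bracket, S.triple_symm y z x, S.triple_symm z y x]; abel
    have hz : S.bracket z (S.bracket y x) = S.triple x y z - S.triple z x y := by
      rw [S.bracket_skew, S.bracket_bracket, S.triple_symm y x z]; abel
    rw [← one_smul F (S.triple x y z), ← h4]
    simp only [left_apply, der_apply, jor_apply, LinearMap.smul_apply, LinearMap.add_apply,
      Prod.snd_add, Prod.fst_add, Prod.smul_snd, Prod.smul_fst, map_smul, hx, hz, symOp_apply,
      Submodule.coe_smul]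
    rw [S.triple_symm y z x, S.triple_symm z y x, S.triple_symm y x z]
    module
  · have hx := S.bracket_comm_symOp x y z
    have hz := S.bracket_comm_symOp z y x
    rw [S.bracket_skew z x] at hz
    rw [S.bracket_skew z y] at hz
    simp only [map_neg, LinearMap.neg_apply] at hz
    simp only [left_apply, der_apply, jor_apply, LinearMap.smul_apply, LinearMap.add_apply,
      Prod.snd_add, Prod.smul_snd, map_smul, Submodule.coe_smul, Submodule.coe_add,
      mul_smul_comm, smul_mul_assoc, ← smul_sub, hx, hz, S.bracket_skew y x, map_neg,
      Submodule.coe_zero]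
    rw [S.symOp_comm x (S.bracket y z), S.symOp_comm z (S.bracket x y)]
    module

/-- Left multiplication respects `T`: the defect is an invariant trilinear map killing the unit,
which generates `Hull`. -/
theorem left_triple (hF : (2 : F) ≠ 0) (x y z : L) :
    S.left (S.triple x y z) =
      S.left x * S.left y * S.left z + S.left z * S.left y * S.left x := by
  -- `d` is the defect, and `N` the common kernel of its values, which is stable under `left`.
  let d (x y z : L) : Module.End F S.Hull :=
    S.left x * S.left y * S.left z + S.left z * S.left y * S.left x - S.left (S.triple x y z)
  have hd (t x y z : L) : d x y z * S.left t = S.left t * d x y z -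
      (d (S.bracket t x) y z + d x (S.bracket t y) z + d x y (S.bracket t z)) := by
    have h := S.left_comm_left hF t (S.triple x y z)
    rw [bracket_triple, map_add, map_add] at h
    simp only [d]
    rw [← S.left_comm_left hF t x, ← S.left_comm_left hF t y, ← S.left_comm_left hF t z]
    linear_combination (norm := skip) h
    simp only [mul_sub, sub_mul, mul_add, add_mul, mul_assoc]
    abel
  let N : Submodule F S.Hull := ⨅ p : L × L × L, LinearMap.ker (d p.1 p.2.1 p.2.2)
  have hN (v : S.Hull) : v ∈ N ↔ ∀ x y z, d x y z v = 0 := by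
    simp [N, Submodule.mem_iInf]
  have hleft (t : L) {v : S.Hull} (hv : v ∈ N) : S.left t v ∈ N := by
    rw [hN] at hv ⊢
    intro x y z
    have := LinearMap.congr_fun (hd t x y z) v
    simpa only [Module.End.mul_apply, LinearMap.sub_apply, LinearMap.add_apply, hv, map_zero,
      add_zero, sub_zero] using this
  have h1 : S.hullOne ∈ N := (hN _).mpr fun x y z => by
    simpa [d, sub_eq_zero] using S.left_triple_hullOne hF x y z
  have hL (x : L) : ((0, x, 0) : S.Hull) ∈ N := S.left_hullOne hF x ▸ hleft x h1
  have hT : N = ⊤ := S.eq_top_of_hullOne_mem hF h1 hL fun x y =>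
    ⟨_, S.left_skew x y ▸ hleft x (hL y)⟩
  refine (sub_eq_zero.mp (LinearMap.ext fun v => ?_ : d x y z = 0)).symm
  exact (hN v).mp (hT ▸ Submodule.mem_top) x y z

/-- An operator commuting with all right multiplications is determined by its value at the unit. -/
theorem eq_zero_of_commute_right (hF : (2 : F) ≠ 0) {f : Module.End F S.Hull}
    (hf : ∀ x, Commute f (S.right x)) (h1 : f S.hullOne = 0) : f = 0 := by
  have hr (x : L) {v : S.Hull} (hv : v ∈ LinearMap.ker f) : S.right x v ∈ LinearMap.ker f := by
    rw [LinearMap.mem_ker] at hv ⊢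
    have := LinearMap.congr_fun (hf x).eq v
    rwa [Module.End.mul_apply, Module.End.mul_apply, hv, map_zero] at this
  have hL (x : L) : ((0, x, 0) : S.Hull) ∈ LinearMap.ker f := S.right_hullOne hF x ▸ hr x h1
  exact LinearMap.ker_eq_top.mp <| S.eq_top_of_hullOne_mem hF h1 hL fun x y =>
    ⟨_, S.right_skew x y ▸ hr x (hL y)⟩

end LieJordanAlgebra

/-! ### Ideals of the skew elements -/

namespace AlgInvolution

variable {F A : Type*} [Field F] [NonUnitalRing A] [Module F A] (σ : AlgInvolution F A)

/-- The subspace `I + I ∘ M` spanned by `I` and the Jordan products `xm + mx` with `x ∈ I`,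
`m ∈ M`. -/
def jordanHull (I M : Submodule F A) : Submodule F A :=
  I ⊔ Submodule.span F {a | ∃ x ∈ I, ∃ m ∈ M, a = x * m + m * x}

theorem le_jordanHull (I M : Submodule F A) : I ≤ jordanHull I M := le_sup_left

theorem mul_add_mul_mem_jordanHull {I M : Submodule F A} {x m : A} (hx : x ∈ I) (hm : m ∈ M) :
    x * m + m * x ∈ jordanHull I M :=
  (le_sup_right : _ ≤ jordanHull I M) (Submodule.subset_span ⟨x, hx, m, hm, rfl⟩)

theorem add_self_mem_iff (hF : (2 : F) ≠ 0) {J : Submodule F A} {a : A} : a + a ∈ J ↔ a ∈ J := by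
  rw [← two_smul F a, J.smul_mem_iff hF]

theorem toLin_mul_add_mul {x y : A} (hx : x ∈ σ.skew) (hy : y ∈ σ.skew) :
    σ.toLin (x * y + y * x) = x * y + y * x := by
  rw [mem_skew] at hx hy
  rw [map_add, σ.map_mul, σ.map_mul, hx, hy]
  noncomm_ring

/-- Jordan products of skew elements span symmetric elements only, so every element of the hull is
the sum of a skew element of `I` and a symmetric one. -/
theorem exists_add_of_mem_jordanHull {I M : Submodule F A} (hI : I ≤ σ.skew) (hM : M ≤ σ.skew)
    {a : A} (ha : a ∈ jordanHull I M) : ∃ x ∈ I,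
      ∃ s ∈ Submodule.span F {a | ∃ x ∈ I, ∃ m ∈ M, a = x * m + m * x}, σ.toLin s = s ∧
        x + s = a := by
  obtain ⟨x, hx, s, hs, rfl⟩ := Submodule.mem_sup.mp ha
  refine ⟨x, hx, s, hs, ?_, rfl⟩
  suffices h : Submodule.span F {a | ∃ x ∈ I, ∃ m ∈ M, a = x * m + m * x} ≤
      LinearMap.eqLocus σ.toLin LinearMap.id from h hs
  refine Submodule.span_le.mpr ?_
  rintro _ ⟨x, hx, m, hm, rfl⟩
  exact σ.toLin_mul_add_mul (hI hx) (hM hm)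

/-- The skew elements of the hull of `I` are those of `I`. -/
theorem mem_of_mem_jordanHull_of_mem_skew (hF : (2 : F) ≠ 0) {I M : Submodule F A}
    (hI : I ≤ σ.skew) (hM : M ≤ σ.skew) {a : A} (ha : a ∈ jordanHull I M) (hs : a ∈ σ.skew) :
    a ∈ I := by
  obtain ⟨x, hx, s, -, hss, rfl⟩ := σ.exists_add_of_mem_jordanHull hI hM ha
  have hx' : σ.toLin x = -x := hI hx
  rw [mem_skew, map_add, hx', hss, neg_add, add_right_inj] at hs
  have h0 : s = 0 := by
    rw [← Submodule.mem_bot F, ← add_self_mem_iff hF, Submodule.mem_bot]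
    nth_rw 1 [hs]
    exact neg_add_cancel s
  rwa [h0, add_zero]

theorem toLin_mem_jordanHull {I M : Submodule F A} (hI : I ≤ σ.skew) (hM : M ≤ σ.skew) {a : A}
    (ha : a ∈ jordanHull I M) : σ.toLin a ∈ jordanHull I M := by
  obtain ⟨x, hx, s, hs, hss, rfl⟩ := σ.exists_add_of_mem_jordanHull hI hM ha
  have hx' : σ.toLin x = -x := hI hx
  rw [map_add, hx', hss]
  exact add_mem (neg_mem (le_jordanHull I M hx)) ((le_sup_right : _ ≤ jordanHull I M) hs)

/-- A `*`-stable left ideal is two-sided. -/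
theorem mul_mem_right_of_star {J : Submodule F A} (hl : ∀ b, ∀ a ∈ J, b * a ∈ J)
    (hs : ∀ a ∈ J, σ.toLin a ∈ J) (b : A) {a : A} (ha : a ∈ J) : a * b ∈ J := by
  have := hs _ (hl (σ.toLin b) _ (hs a ha))
  rwa [σ.map_mul, σ.involutive, σ.involutive] at this

variable [SMulCommClass F A A]

/-- The Jordan hull of an ideal is stable under multiplication by the ambient Lie-Jordan algebra:
`2(mxn + mnx)` equals `T(m, x, n) + T(m, n, x)` plus the Jordan products `[m, x] ∘ n` and
`x ∘ [m, n]`. -/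
theorem mul_mem_jordanHull (hF : (2 : F) ≠ 0) {I M : Submodule F A}
    (hb : ∀ m ∈ M, ∀ x ∈ I, m * x - x * m ∈ I)
    (hbM : ∀ m ∈ M, ∀ n ∈ M, m * n - n * m ∈ M)
    (ht : ∀ x ∈ I, ∀ m ∈ M, ∀ n ∈ M, m * x * n + n * x * m ∈ I ∧ m * n * x + x * n * m ∈ I)
    {m a : A} (hm : m ∈ M) (ha : a ∈ jordanHull I M) : m * a ∈ jordanHull I M := by
  suffices h : jordanHull I M ≤ (jordanHull I M).comap (LinearMap.mulLeft F m) from h ha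
  refine sup_le (fun x hx => ?_) (Submodule.span_le.mpr ?_)
  · rw [Submodule.mem_comap, LinearMap.mulLeft_apply, ← add_self_mem_iff hF]
    convert add_mem (le_jordanHull I M (hb m hm x hx)) (mul_add_mul_mem_jordanHull hx hm) using 1
    noncomm_ring
  · rintro _ ⟨x, hx, n, hn, rfl⟩
    rw [SetLike.mem_coe, Submodule.mem_comap, LinearMap.mulLeft_apply, ← add_self_mem_iff hF]
    obtain ⟨h1, h2⟩ := ht x hx m hm n hn
    convert add_mem (le_jordanHull I M (add_mem h1 h2))
      (add_mem (mul_add_mul_mem_jordanHull (hb m hm x hx) hn)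
        (mul_add_mul_mem_jordanHull hx (hbM m hm n hn))) using 1
    noncomm_ring

variable [IsScalarTower F A A]

/-- If all products of `A` by generators stay in `J`, then `J` is a left ideal. -/
theorem mul_mem_of_adjoin_eq_top {M J : Submodule F A}
    (hM : NonUnitalAlgebra.adjoin F (M : Set A) = ⊤) (h : ∀ m ∈ M, ∀ a ∈ J, m * a ∈ J)
    (b : A) {a : A} (ha : a ∈ J) : b * a ∈ J := by
  have hb : b ∈ NonUnitalAlgebra.adjoin F (M : Set A) := hM ▸ NonUnitalAlgebra.mem_top
  induction hb using NonUnitalAlgebra.adjoin_induction generalizing a with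
  | mem x hx => exact h x hx a ha
  | add x y _ _ hx hy => exact add_mul x y a ▸ add_mem (hx ha) (hy ha)
  | zero => exact (zero_mul a).symm ▸ zero_mem _
  | mul x y _ _ hx hy => exact (mul_assoc x y a).symm ▸ hx (hy ha)
  | smul c x _ hx => exact (smul_mul_assoc c x a).symm ▸ J.smul_mem c (hx ha)

/-- An algebra generated by a subspace closed under the Lie-Jordan operations is already spanned by
it and the Jordan products of its elements. -/
theorem jordanHull_self_eq_top (hF : (2 : F) ≠ 0) {M : Submodule F A}
    (hbM : ∀ m ∈ M, ∀ n ∈ M, m * n - n * m ∈ M)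
    (ht : ∀ x ∈ M, ∀ m ∈ M, ∀ n ∈ M, m * x * n + n * x * m ∈ M)
    (hM : NonUnitalAlgebra.adjoin F (M : Set A) = ⊤) : jordanHull M M = ⊤ := by
  have hl (b : A) {a : A} (ha : a ∈ jordanHull M M) : b * a ∈ jordanHull M M :=
    mul_mem_of_adjoin_eq_top hM (fun m hm a ha => mul_mem_jordanHull hF hbM hbM
      (fun x hx m hm n hn => ⟨ht x hx m hm n hn, ht n hn m hm x hx⟩) hm ha) b ha
  refine Submodule.eq_top_iff'.mpr fun a => ?_
  have ha : a ∈ NonUnitalAlgebra.adjoin F (M : Set A) := hM ▸ NonUnitalAlgebra.mem_top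
  induction ha using NonUnitalAlgebra.adjoin_induction with
  | mem x hx => exact le_jordanHull M M hx
  | add x y _ _ hx hy => exact add_mem hx hy
  | zero => exact zero_mem _
  | mul x y _ _ _ hy => exact hl x hy
  | smul c x _ hx => exact Submodule.smul_mem _ c hx

theorem mul_eq_zero_of_adjoin_eq_top {M : Submodule F A}
    (hM : NonUnitalAlgebra.adjoin F (M : Set A) = ⊤) {u : A} (h : ∀ m ∈ M, u * m = 0) (a : A) :
    u * a = 0 := by
  have ha : a ∈ NonUnitalAlgebra.adjoin F (M : Set A) := hM ▸ NonUnitalAlgebra.mem_top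
  induction ha using NonUnitalAlgebra.adjoin_induction with
  | mem x hx => exact h x hx
  | add x y _ _ hx hy => rw [mul_add, hx, hy, add_zero]
  | zero => exact mul_zero u
  | mul x y _ _ hx _ => rw [← mul_assoc, hx, zero_mul]
  | smul c x _ hx => rw [mul_smul_comm, hx, smul_zero]

theorem skewLieJordan_ideal_eq_bot_or_top (hF : (2 : F) ≠ 0) (hs : σ.IsStarSimple)
    (hg : σ.GeneratedBySkew) {I : Submodule F σ.skew} (hI : σ.skewLieJordan.IsIdeal I) :
    I = ⊥ ∨ I = ⊤ := by
  set I' := I.map σ.skew.subtype with hI'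
  have hle : I' ≤ σ.skew := Submodule.map_subtype_le _ _
  have mem (x : σ.skew) : (x : A) ∈ I' ↔ x ∈ I := by simp [hI']
  let J := jordanHull I' σ.skew
  have hl : ∀ b, ∀ a ∈ J, b * a ∈ J := fun b a ha => by
    refine mul_mem_of_adjoin_eq_top hg (fun m hm a ha => ?_) b ha
    refine mul_mem_jordanHull hF ?_ (fun m hm n hn => σ.bracket_mem_skew hm hn) ?_ hm ha
    · intro m hm x hx
      exact (mem _).mpr (hI.1 ⟨m, hm⟩ ⟨x, hle hx⟩ (Or.inr ((mem ⟨x, hle hx⟩).mp hx)))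
    · intro x hx m hm n hn
      have hx' := (mem ⟨x, hle hx⟩).mp hx
      exact ⟨(mem _).mpr (hI.2 ⟨m, hm⟩ ⟨x, hle hx⟩ ⟨n, hn⟩ (Or.inr (Or.inl hx'))),
        (mem _).mpr (hI.2 ⟨m, hm⟩ ⟨n, hn⟩ ⟨x, hle hx⟩ (Or.inr (Or.inr hx')))⟩
  have hst : ∀ a ∈ J, σ.toLin a ∈ J := fun a ha => σ.toLin_mem_jordanHull hle le_rfl ha
  rcases hs.2 J (fun b a ha => ⟨hl b a ha, σ.mul_mem_right_of_star hl hst b ha⟩) hst with h | h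
  · refine Or.inl ((Submodule.eq_bot_iff _).mpr fun x hx => Subtype.ext ?_)
    have : (x : A) ∈ J := le_jordanHull _ _ ((mem x).mpr hx)
    rwa [h, Submodule.mem_bot] at this
  · refine Or.inr (Submodule.eq_top_iff'.mpr fun x => (mem x).mp ?_)
    exact σ.mem_of_mem_jordanHull_of_mem_skew hF hle le_rfl
      (show (x : A) ∈ J from h ▸ Submodule.mem_top) x.2

/-- If both operations of `K(A, *)` vanish, then skew elements commute and all products of three of
them are zero. The annihilator `N` of `A` is a `*`-ideal, hence zero; it contains the products of two
skew elements, which therefore vanish, and then the skew elements themselves. -/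
theorem skewLieJordan_ne_zero (hF : (2 : F) ≠ 0) (hs : σ.IsStarSimple) (hg : σ.GeneratedBySkew) :
    σ.skewLieJordan.bracket ≠ 0 ∨ σ.skewLieJordan.triple ≠ 0 := by
  by_contra! h
  have hb {x y : A} (hx : x ∈ σ.skew) (hy : y ∈ σ.skew) : x * y = y * x := by
    have h1 := σ.coe_skewLieJordan_bracket ⟨x, hx⟩ ⟨y, hy⟩
    rw [h.1] at h1
    exact (sub_eq_zero.mp h1.symm)
  have ht {x y z : A} (hx : x ∈ σ.skew) (hy : y ∈ σ.skew) (hz : z ∈ σ.skew) :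
      x * y * z = 0 := by
    have h1 := σ.coe_skewLieJordan_triple ⟨x, hx⟩ ⟨y, hy⟩ ⟨z, hz⟩
    have h2 : z * y * x = x * y * z := by
      rw [mul_assoc, hb hy hx, ← mul_assoc, hb hz hx, mul_assoc, hb hz hy, ← mul_assoc]
    rw [h.2, h2] at h1
    rw [← Submodule.mem_bot F, ← add_self_mem_iff hF, Submodule.mem_bot]
    exact h1.symm
  let N : Submodule F A :=
    { carrier := {a | ∀ b, b * a = 0 ∧ a * b = 0}
      add_mem' := fun {a a'} ha ha' b => by simp [mul_add, add_mul, ha b, ha' b]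
      zero_mem' := by simp
      smul_mem' := fun c a ha b => by simp [mul_smul_comm, smul_mul_assoc, ha b] }
  have hN : N = ⊥ := by
    refine (hs.2 N (fun b a ha => ⟨?_, ?_⟩) fun a ha b => ⟨?_, ?_⟩).resolve_right fun hN => ?_
    · rw [(ha b).1]; exact N.zero_mem
    · rw [(ha b).2]; exact N.zero_mem
    · rw [← σ.involutive b, ← σ.map_mul, (ha _).2, map_zero]
    · rw [← σ.involutive b, ← σ.map_mul, (ha _).1, map_zero]
    · obtain ⟨a, b, hab⟩ := hs.1
      exact hab ((hN ▸ Submodule.mem_top : a ∈ N) b).2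
  -- For a symmetric or skew element, annihilation on one side implies it on the other.
  have hz {ε : F} (hε : ε ≠ 0) {u : A} (hu : σ.toLin u = ε • u)
      (h : ∀ m ∈ σ.skew, u * m = 0) : u = 0 := by
    have h0 := mul_eq_zero_of_adjoin_eq_top hg h
    have h1 (b : A) : ε • (b * u) = 0 := by
      rw [← mul_smul_comm, ← hu, ← σ.involutive b, ← σ.map_mul, h0, map_zero]
    rw [← Submodule.mem_bot F, ← hN]
    exact fun b => ⟨(smul_eq_zero_iff_right hε).mp (h1 b), h0 b⟩
  have hmn {m n : A} (hm : m ∈ σ.skew) (hn : n ∈ σ.skew) : m * n = 0 := by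
    refine hz one_ne_zero ?_ fun k hk => ht hm hn hk
    rw [σ.map_mul, σ.mem_skew.mp hm, σ.mem_skew.mp hn, neg_mul_neg, one_smul, hb hn hm]
  have hm {m : A} (hm : m ∈ σ.skew) : m = 0 :=
    hz (neg_ne_zero.mpr one_ne_zero) (by rw [σ.mem_skew.mp hm, neg_one_smul]) fun k hk => hmn hm hk
  obtain ⟨a, b, hab⟩ := hs.1
  exact hab (mul_eq_zero_of_adjoin_eq_top hg (fun m hm' => by rw [hm hm', mul_zero]) b)

theorem isSimple_skewLieJordan (hF : (2 : F) ≠ 0) (hs : σ.IsStarSimple)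
    (hg : σ.GeneratedBySkew) : σ.skewLieJordan.IsSimple :=
  ⟨σ.skewLieJordan_ne_zero hF hs hg, fun _ hI => σ.skewLieJordan_ideal_eq_bot_or_top hF hs hg hI⟩

end AlgInvolution

/-! ### Exchange involutions -/

namespace AlgInvolution

/-- The exchange involution `(a, b) ↦ (b, a)` of the product of an algebra and its opposite. -/
def exchange (F B : Type*) [Field F] [NonUnitalRing B] [Module F B] :
    AlgInvolution F (B × Bᵐᵒᵖ) where
  toLin := LinearMap.prod
    ((MulOpposite.opLinearEquiv F).symm.toLinearMap ∘ₗ LinearMap.snd F B Bᵐᵒᵖ)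
    ((MulOpposite.opLinearEquiv F).toLinearMap ∘ₗ LinearMap.fst F B Bᵐᵒᵖ)
  map_mul _ _ := rfl
  involutive _ := rfl

variable {F A : Type*} [Field F] [NonUnitalRing A] [Module F A] (σ : AlgInvolution F A)
  [IsScalarTower F A A] [SMulCommClass F A A]

/-- The restriction of an involution to the subalgebra generated by a set of skew elements. -/
def restrictAdjoin (s : Set A) (hs : s ⊆ σ.skew) :
    AlgInvolution F (NonUnitalAlgebra.adjoin F s) where
  toLin := (σ.toLin ∘ₗ (NonUnitalAlgebra.adjoin F s).toSubmodule.subtype).codRestrict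
    (NonUnitalAlgebra.adjoin F s).toSubmodule fun ⟨a, ha⟩ => by
      change σ.toLin a ∈ NonUnitalAlgebra.adjoin F s
      induction ha using NonUnitalAlgebra.adjoin_induction with
      | mem x hx =>
        rw [σ.mem_skew.mp (hs hx)]
        exact neg_mem (NonUnitalAlgebra.subset_adjoin F hx)
      | add x y _ _ hx hy => rw [map_add]; exact add_mem hx hy
      | zero => rw [map_zero]; exact zero_mem _
      | mul x y _ _ hx hy => rw [σ.map_mul]; exact mul_mem hy hx
      | smul c x _ hx => rw [map_smul]; exact SMulMemClass.smul_mem c hx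
  map_mul a b := Subtype.ext (σ.map_mul a b)
  involutive a := Subtype.ext (σ.involutive a)

end AlgInvolution

/-! ### Embeddings as generating skew elements, and the associative envelope -/

namespace LieJordanAlgebra

open AlgInvolution

variable {F L : Type*} [Field F] [AddCommGroup L] [Module F L] (S : LieJordanAlgebra F L)

/-- An embedding of `L` into the Lie-Jordan algebra of skew elements of `(A, *)` whose image
generates `A`. -/
structure SkewEmbedding {A : Type*} [NonUnitalRing A] [Module F A] [IsScalarTower F A A]
    [SMulCommClass F A A] (σ : AlgInvolution F A) where
  /-- the underlying linear map -/
  map : L →ₗ[F] A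
  injective : Function.Injective map
  mem_skew : ∀ x, map x ∈ σ.skew
  map_bracket : ∀ x y, map (S.bracket x y) = map x * map y - map y * map x
  map_triple : ∀ x y z,
    map (S.triple x y z) = map x * map y * map z + map z * map y * map x
  adjoin_range : NonUnitalAlgebra.adjoin F (LinearMap.range map : Set A) = ⊤

namespace SkewEmbedding

variable {S} {A : Type*} [NonUnitalRing A] [Module F A] [IsScalarTower F A A]
  [SMulCommClass F A A] {σ : AlgInvolution F A}

theorem range_le_skew (E : S.SkewEmbedding σ) : LinearMap.range E.map ≤ σ.skew := by
  rintro _ ⟨x, rfl⟩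
  exact E.mem_skew x

theorem jordanHull_range (E : S.SkewEmbedding σ) (hF : (2 : F) ≠ 0) :
    jordanHull (LinearMap.range E.map) (LinearMap.range E.map) = ⊤ := by
  refine jordanHull_self_eq_top hF ?_ ?_ E.adjoin_range
  · rintro _ ⟨x, rfl⟩ _ ⟨y, rfl⟩
    exact ⟨_, E.map_bracket x y⟩
  · rintro _ ⟨x, rfl⟩ _ ⟨y, rfl⟩ _ ⟨z, rfl⟩
    exact ⟨_, E.map_triple y x z⟩

theorem exists_map_eq (E : S.SkewEmbedding σ) (hF : (2 : F) ≠ 0) {a : A} (ha : a ∈ σ.skew) :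
    ∃ x, E.map x = a :=
  σ.mem_of_mem_jordanHull_of_mem_skew hF E.range_le_skew E.range_le_skew
    (E.jordanHull_range hF ▸ Submodule.mem_top) ha

theorem generatedBySkew (E : S.SkewEmbedding σ) : σ.GeneratedBySkew :=
  top_le_iff.mp (E.adjoin_range ▸ NonUnitalAlgebra.adjoin_mono E.range_le_skew)

theorem isomorphic (E : S.SkewEmbedding σ) (hF : (2 : F) ≠ 0) : S.Isomorphic σ.skewLieJordan := by
  refine ⟨LinearEquiv.ofBijective (E.map.codRestrict σ.skew E.mem_skew) ⟨?_, fun a => ?_⟩, ?_, ?_⟩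
  · exact fun x y h => E.injective (congrArg Subtype.val h)
  · obtain ⟨x, hx⟩ := E.exists_map_eq hF a.2
    exact ⟨x, Subtype.ext hx⟩
  · exact fun x y => Subtype.ext (E.map_bracket x y)
  · exact fun x y z => Subtype.ext (E.map_triple x y z)

/-- An algebra generated by a simple Lie-Jordan algebra of skew elements is `*`-simple, provided
that no nonzero symmetric element annihilates all of them under Jordan multiplication: a `*`-ideal
without nonzero skew elements consists of such symmetric elements. -/
theorem isStarSimple (E : S.SkewEmbedding σ) (hF : (2 : F) ≠ 0) (hS : S.IsSimple)
    (hfaith : ∀ a, σ.toLin a = a → (∀ x, a * E.map x + E.map x * a = 0) → a = 0) :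
    σ.IsStarSimple := by
  constructor
  · by_contra! h
    refine hS.1.elim (fun h' => h' ?_) (fun h' => h' ?_)
    · exact LinearMap.ext₂ fun x y => E.injective (by simp [E.map_bracket, h])
    · exact LinearMap.ext₂ fun x y => LinearMap.ext fun z => E.injective (by simp [E.map_triple, h])
  intro I hI hst
  have hid : S.IsIdeal (I.comap E.map) := by
    refine ⟨fun x y h => ?_, fun x y z h => ?_⟩ <;> rw [Submodule.mem_comap]
    · rw [E.map_bracket]
      rcases h with h | h
      · exact sub_mem (hI _ _ h).2 (hI _ _ h).1
      · exact sub_mem (hI _ _ h).1 (hI _ _ h).2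
    · rw [E.map_triple]
      rcases h with h | h | h
      · exact add_mem (hI _ _ (hI _ _ h).2).2 (hI _ _ h).1
      · exact add_mem (hI _ _ (hI _ _ h).1).2 (hI _ _ (hI _ _ h).1).2
      · exact add_mem (hI _ _ h).1 (hI _ _ (hI _ _ h).2).2
  refine (hS.2 _ hid).imp (fun h => ?_) (fun h => ?_)
  · have h0 {a : A} (ha : a ∈ I) (hs : a ∈ σ.skew) : a = 0 := by
      obtain ⟨x, rfl⟩ := E.exists_map_eq hF hs
      rw [(Submodule.eq_bot_iff _).mp h x ha, map_zero]
    refine (Submodule.eq_bot_iff _).mpr fun a ha => ?_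
    have hsym : σ.toLin a = a := by
      rw [← sub_eq_zero]
      refine h0 (sub_mem (hst a ha) ha) ?_
      rw [AlgInvolution.mem_skew, map_sub, σ.involutive, neg_sub]
    refine hfaith a hsym fun x => h0 (add_mem (hI _ _ ha).2 (hI _ _ ha).1) ?_
    rw [AlgInvolution.mem_skew, map_add, σ.map_mul, σ.map_mul, hsym, σ.mem_skew.mp (E.mem_skew x)]
    noncomm_ring
  · refine Submodule.eq_top_iff'.mpr fun a => ?_
    have ha : a ∈ NonUnitalAlgebra.adjoin F (LinearMap.range E.map : Set A) :=
      E.adjoin_range ▸ NonUnitalAlgebra.mem_top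
    induction ha using NonUnitalAlgebra.adjoin_induction with
    | mem x hx =>
      obtain ⟨y, rfl⟩ := hx
      exact (h ▸ Submodule.mem_top : y ∈ I.comap E.map)
    | add x y _ _ hx hy => exact add_mem hx hy
    | zero => exact zero_mem _
    | mul x y _ _ _ hy => exact (hI x y hy).1
    | smul c x _ hx => exact Submodule.smul_mem _ c hx

/-- On the span of the Jordan products, the Jordan action on `L` is the symmetric component of the
value at the unit. -/
theorem exists_symSpan_of_mem_span (E : S.SkewEmbedding σ) (hF : (2 : F) ≠ 0)
    (φ : A →ₙₐ[F] Module.End F S.Hull)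
    (hφ : ∀ x, φ (E.map x) = S.left x) {a : A}
    (ha : a ∈ Submodule.span F {a | ∃ x ∈ LinearMap.range E.map,
      ∃ y ∈ LinearMap.range E.map, a = x * y + y * x}) :
    ∃ h : S.symSpan, φ a S.hullOne = (0, 0, h) ∧
      ∀ k, a * E.map k + E.map k * a =
        E.map ((h : Module.End F L) k) := by
  induction ha using Submodule.span_induction with
  | mem a ha =>
    obtain ⟨_, ⟨x, rfl⟩, _, ⟨y, rfl⟩, rfl⟩ := ha
    refine ⟨⟨S.symOp x y, S.symOp_mem x y⟩, ?_, fun k => ?_⟩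
    · rw [map_add, _root_.map_mul, _root_.map_mul, hφ, hφ, LinearMap.add_apply, Module.End.mul_apply,
        Module.End.mul_apply, S.left_hullOne hF, S.left_hullOne hF, left_skew, left_skew]
      refine Prod.ext ?_ (Prod.ext ?_ (Subtype.ext ?_))
      · simp
      · simp [S.bracket_skew y x]
      · simp only [S.symOp_comm y x, Prod.snd_add, Submodule.coe_add, Submodule.coe_smul]
        rw [← smul_add, ← two_smul F, smul_smul, inv_mul_cancel₀ hF, one_smul]
    · rw [symOp_apply, map_add, E.map_triple, E.map_triple]
      noncomm_ring
  | zero => exact ⟨0, by rw [map_zero]; rfl, fun k => by simp⟩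
  | add a b _ _ ha hb =>
    obtain ⟨g, hg, hg'⟩ := ha
    obtain ⟨h, hh, hh'⟩ := hb
    refine ⟨g + h, ?_, fun k => ?_⟩
    · rw [map_add, LinearMap.add_apply, hg, hh]
      simp
    · rw [Submodule.coe_add, LinearMap.add_apply, map_add, ← hg', ← hh']
      noncomm_ring
  | smul c a _ ha =>
    obtain ⟨h, hh, hh'⟩ := ha
    refine ⟨c • h, ?_, fun k => ?_⟩
    · rw [map_smul, LinearMap.smul_apply, hh]
      simp
    · rw [Submodule.coe_smul, LinearMap.smul_apply, map_smul, ← hh', smul_add, smul_mul_assoc,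
        mul_smul_comm]

/-- No nonzero symmetric element annihilates `L` under Jordan multiplication, as soon as `A` acts on
`Hull` extending `left` and faithfully on symmetric elements. -/
theorem eq_zero_of_jordan_eq_zero (E : S.SkewEmbedding σ) (hF : (2 : F) ≠ 0)
    (φ : A →ₙₐ[F] Module.End F S.Hull)
    (hφ : ∀ x, φ (E.map x) = S.left x) (hφσ : ∀ a, σ.toLin a = a → φ a = 0 → a = 0) {a : A}
    (hs : σ.toLin a = a) (h0 : ∀ x, a * E.map x + E.map x * a = 0) : a = 0 := by
  refine hφσ a hs ?_
  obtain ⟨_, ⟨x, rfl⟩, s, hsp, hss, rfl⟩ :=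
    σ.exists_add_of_mem_jordanHull E.range_le_skew E.range_le_skew
      (E.jordanHull_range hF ▸ Submodule.mem_top : a ∈ _)
  -- `a` is symmetric, so its skew part vanishes.
  have hx : E.map x = 0 := by
    rw [map_add, hss, add_left_inj, σ.mem_skew.mp (E.mem_skew x)] at hs
    rw [← Submodule.mem_bot F, ← add_self_mem_iff hF, Submodule.mem_bot]
    nth_rw 1 [← hs]
    exact neg_add_cancel _
  rw [hx, zero_add] at h0 ⊢
  obtain ⟨h, h1, hk⟩ := E.exists_symSpan_of_mem_span hF φ hφ hsp
  have hh : h = 0 := Subtype.ext <| LinearMap.ext fun k =>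
    E.injective (by rw [← hk, h0]; simp)
  refine S.eq_zero_of_commute_right hF (fun y => ?_) (by rw [h1, hh]; rfl)
  have hs : s ∈ NonUnitalAlgebra.adjoin F (LinearMap.range E.map : Set A) :=
    E.adjoin_range ▸ NonUnitalAlgebra.mem_top
  clear * - hs hφ
  induction hs using NonUnitalAlgebra.adjoin_induction with
  | mem a ha =>
    obtain ⟨x, rfl⟩ := ha
    rw [hφ]
    exact S.commute_left_right x y
  | add a b _ _ ha hb => rw [map_add]; exact Commute.add_left ha hb
  | zero => rw [map_zero]; exact Commute.zero_left _
  | mul a b _ _ ha hb => rw [_root_.map_mul]; exact Commute.mul_left ha hb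
  | smul c a _ ha => rw [map_smul]; exact Commute.smul_left ha c

end SkewEmbedding

/-- The map `x ↦ (left x, -left x)` of `L` into the skew elements of the exchange involution. -/
def doubleLeft : L →ₗ[F] Module.End F S.Hull × (Module.End F S.Hull)ᵐᵒᵖ :=
  LinearMap.prod S.left (-((MulOpposite.opLinearEquiv F).toLinearMap ∘ₗ S.left))

theorem doubleLeft_apply (x : L) :
    S.doubleLeft x = (S.left x, -MulOpposite.op (S.left x)) := rfl

theorem doubleLeft_mem_skew (x : L) : S.doubleLeft x ∈ (exchange F (Module.End F S.Hull)).skew :=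
  Prod.ext (by simp [doubleLeft_apply, exchange]) (by simp [doubleLeft_apply, exchange])

theorem doubleLeft_bracket (hF : (2 : F) ≠ 0) (x y : L) : S.doubleLeft (S.bracket x y) =
    S.doubleLeft x * S.doubleLeft y - S.doubleLeft y * S.doubleLeft x := by
  have h := S.left_comm_left hF x y
  refine Prod.ext h.symm (MulOpposite.unop_injective ?_)
  have key {R : Type _} [Ring R] (a b : R) : -(a * b - b * a) = -b * -a - -a * -b := by
    noncomm_ring
  exact (congrArg Neg.neg h.symm).trans (key (S.left x) (S.left y))

theorem doubleLeft_triple (hF : (2 : F) ≠ 0) (x y z : L) : S.doubleLeft (S.triple x y z) =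
    S.doubleLeft x * S.doubleLeft y * S.doubleLeft z +
      S.doubleLeft z * S.doubleLeft y * S.doubleLeft x := by
  have h := S.left_triple hF x y z
  refine Prod.ext h (MulOpposite.unop_injective ?_)
  have key {R : Type _} [Ring R] (a b c : R) :
      -(a * b * c + c * b * a) = -c * (-b * -a) + -a * (-b * -c) := by
    noncomm_ring
  exact (congrArg Neg.neg h).trans (key (S.left x) (S.left y) (S.left z))

theorem doubleLeft_injective (hF : (2 : F) ≠ 0) : Function.Injective S.doubleLeft := by
  intro x y h
  have h1 := LinearMap.congr_fun (congrArg Prod.fst h) S.hullOne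
  exact congrArg (fun v : S.Hull => v.2.1)
    ((S.left_hullOne hF x).symm.trans (h1.trans (S.left_hullOne hF y)))

/-- The associative envelope of `L`: the algebra of pairs generated by the `doubleLeft x`. -/
abbrev envelope : NonUnitalSubalgebra F (Module.End F S.Hull × (Module.End F S.Hull)ᵐᵒᵖ) :=
  NonUnitalAlgebra.adjoin F (Set.range S.doubleLeft)

/-- The involution of the envelope, which acts as `-1` on the image of `L`. -/
def envelopeInvolution : AlgInvolution F S.envelope :=
  (exchange F (Module.End F S.Hull)).restrictAdjoin (Set.range S.doubleLeft)
    (Set.range_subset_iff.mpr S.doubleLeft_mem_skew)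

/-- The embedding of `L` into its envelope. -/
def toEnvelope : L →ₗ[F] S.envelope :=
  S.doubleLeft.codRestrict S.envelope.toSubmodule fun x =>
    NonUnitalAlgebra.subset_adjoin F (Set.mem_range_self x)

theorem adjoin_range_toEnvelope :
    NonUnitalAlgebra.adjoin F (LinearMap.range S.toEnvelope : Set S.envelope) = ⊤ := by
  refine NonUnitalSubalgebra.ext fun a => iff_of_true ?_ NonUnitalAlgebra.mem_top
  obtain ⟨a, ha⟩ := a
  induction ha using NonUnitalAlgebra.adjoin_induction with
  | mem x hx =>
    obtain ⟨y, rfl⟩ := hx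
    exact NonUnitalAlgebra.subset_adjoin F ⟨y, rfl⟩
  | add x y _ _ hx hy => exact add_mem hx hy
  | zero => exact zero_mem _
  | mul x y _ _ hx hy => exact mul_mem hx hy
  | smul c x _ hx => exact SMulMemClass.smul_mem c hx

/-- The embedding of `L` into its envelope as a generating set of skew elements. -/
def envelopeEmbedding (hF : (2 : F) ≠ 0) : S.SkewEmbedding S.envelopeInvolution where
  map := S.toEnvelope
  injective _ _ h := S.doubleLeft_injective hF (congrArg Subtype.val h)
  mem_skew x := Subtype.ext (S.doubleLeft_mem_skew x)
  map_bracket x y := Subtype.ext (S.doubleLeft_bracket hF x y)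
  map_triple x y z := Subtype.ext (S.doubleLeft_triple hF x y z)
  adjoin_range := S.adjoin_range_toEnvelope

/-- The first component of elements of the envelope, as a representation on `Hull`. -/
def envelopeFst : S.envelope →ₙₐ[F] Module.End F S.Hull :=
  (NonUnitalAlgHom.fst F _ _).comp (NonUnitalSubalgebraClass.subtype S.envelope)

theorem eq_zero_of_envelopeFst_eq_zero {a : S.envelope} (hs : S.envelopeInvolution.toLin a = a)
    (h : S.envelopeFst a = 0) : a = 0 := by
  have h1 : a.1.1 = 0 := h
  -- A symmetric pair has equal components.
  have h2 : a.1.2 = MulOpposite.op a.1.1 := (congrArg (fun b => b.1.2) hs).symm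
  exact Subtype.ext (Prod.ext h1 (by rw [h2, h1]; rfl))

theorem isStarSimple_envelope (hF : (2 : F) ≠ 0) (hS : S.IsSimple) :
    S.envelopeInvolution.IsStarSimple :=
  (S.envelopeEmbedding hF).isStarSimple hF hS fun _ hs h0 =>
    (S.envelopeEmbedding hF).eq_zero_of_jordan_eq_zero hF S.envelopeFst (fun _ => rfl)
      (fun _ => S.eq_zero_of_envelopeFst_eq_zero) hs h0

end LieJordanAlgebra

theorem mainTheorem4 {F : Type v} [Field F] (hF : (2 : F) ≠ 0) :
    (∀ (L : Type u) [AddCommGroup L] [Module F L] (S : LieJordanAlgebra F L), S.IsSimple →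
      ∃ (A : Type (max u v)) (_ : NonUnitalRing A) (_ : Module F A)
        (_ : IsScalarTower F A A) (_ : SMulCommClass F A A) (σ : AlgInvolution F A),
        σ.IsStarSimple ∧ σ.GeneratedBySkew ∧ S.Isomorphic σ.skewLieJordan) ∧
    (∀ (A : Type w) [NonUnitalRing A] [Module F A] [IsScalarTower F A A] [SMulCommClass F A A]
      (σ : AlgInvolution F A), σ.IsStarSimple → σ.GeneratedBySkew → σ.skewLieJordan.IsSimple) := by
  refine ⟨fun L _ _ S hS => ?_, fun A _ _ _ _ σ hs hg => σ.isSimple_skewLieJordan hF hs hg⟩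
  exact ⟨S.envelope, inferInstance, inferInstance, inferInstance, inferInstance,
    S.envelopeInvolution, S.isStarSimple_envelope hF hS, (S.envelopeEmbedding hF).generatedBySkew,
    (S.envelopeEmbedding hF).isomorphic hF⟩
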